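/- Let $H$ be an infinite-dimensional complex Hilbert space (not necessarily separable) and let $\mathcal V\subseteq \mathcal B(H)$ be an operator system, i.e. a (not necessarily closed) complex linear subspace of the bounded operators on $H$ that contains the identity $I_H$ and satisfies $A^*\in\mathcal V$ whenever $A\in\mathcal V$. For a projection $P$ write $P\mathcal V P=\{PAP : A\in\mathcal V\}$. Then there is an orthogonal projection $P\in\mathcal B(H)$ of infinite rank for which at least one of the following holds: 1. ($P$ is an infinite quantum clique) $P\mathcal V P$ is dense in $P\mathcal B(H)P$ with respect to the weak operator topology; 2. ($P$ is an infinite quantum anticlique) $P\mathcal V P=\mathbb C P$; 3. ($P$ is an infinite quantum obstruction) $P\mathcal V P$ is finite-dimensional, every operator in $P\mathcal V P$ is the sum of a scalar multiple of $P$ and a compact operator, and $P\mathcal V P$ contains a self-adjoint compact operator whose range is dense in $PH$. -/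

import Mathlib

/-- An operator system on `H`: a (not necessarily closed) linear subspace of `B(H)` that contains
the identity operator and is closed under adjoints. -/
structure IsOperatorSystem {H : Type*} [NormedAddCommGroup H] [InnerProductSpace ℂ H]
    [CompleteSpace H] (V : Submodule ℂ (H →L[ℂ] H)) : Prop where
  one_mem : (1 : H →L[ℂ] H) ∈ V
  adjoint_mem : ∀ A ∈ V, ContinuousLinearMap.adjoint A ∈ V

/-- The compression `P V P = {P A P : A ∈ V}`. -/
def compression {H : Type*} [NormedAddCommGroup H] [InnerProductSpace ℂ H]
    (P : H →L[ℂ] H) (V : Submodule ℂ (H →L[ℂ] H)) : Submodule ℂ (H →L[ℂ] H) :=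
  V.map (LinearMap.mulLeftRight ℂ (P, P))

theorem mem_compression {H : Type*} [NormedAddCommGroup H] [InnerProductSpace ℂ H]
    (P : H →L[ℂ] H) (V : Submodule ℂ (H →L[ℂ] H)) (B : H →L[ℂ] H) :
    B ∈ compression P V ↔ ∃ A ∈ V, P * A * P = B := by
  simp [compression, Submodule.mem_map]

/-- `P` is an orthogonal projection of infinite rank. -/
def IsInfiniteRankProjection {H : Type*} [NormedAddCommGroup H] [InnerProductSpace ℂ H]
    [CompleteSpace H] (P : H →L[ℂ] H) : Prop :=
  IsStarProjection P ∧ ¬ FiniteDimensional ℂ P.range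

/-- `P` is an infinite quantum clique of `V`: an orthogonal projection of infinite rank such that
`P V P` is dense in `P B(H) P` for the weak operator topology. -/
def IsInfiniteQuantumClique {H : Type*} [NormedAddCommGroup H] [InnerProductSpace ℂ H]
    [CompleteSpace H] (V : Submodule ℂ (H →L[ℂ] H)) (P : H →L[ℂ] H) : Prop :=
  IsInfiniteRankProjection P ∧
    (ContinuousLinearMapWOT.ofCLM '' (compression P ⊤ : Set (H →L[ℂ] H)) : Set (H →WOT[ℂ] H)) ⊆
      closure (ContinuousLinearMapWOT.ofCLM '' (compression P V : Set (H →L[ℂ] H)))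

/-- `P` is an infinite quantum anticlique of `V`: an orthogonal projection of infinite rank such
that `P V P = ℂ P`. -/
def IsInfiniteQuantumAnticlique {H : Type*} [NormedAddCommGroup H] [InnerProductSpace ℂ H]
    [CompleteSpace H] (V : Submodule ℂ (H →L[ℂ] H)) (P : H →L[ℂ] H) : Prop :=
  IsInfiniteRankProjection P ∧ compression P V = Submodule.span ℂ {P}

/-- `P` is an infinite quantum obstruction of `V`: an orthogonal projection of infinite rank such
that `P V P` is finite-dimensional, each of its elements is the sum of a scalar multiple of `P` and
a compact operator, and it contains a self-adjoint compact operator whose range is dense in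
`P H`. -/
structure IsInfiniteQuantumObstruction {H : Type*} [NormedAddCommGroup H]
    [InnerProductSpace ℂ H] [CompleteSpace H] (V : Submodule ℂ (H →L[ℂ] H))
    (P : H →L[ℂ] H) : Prop where
  isInfiniteRankProjection : IsInfiniteRankProjection P
  finiteDimensional : FiniteDimensional ℂ (compression P V)
  scalar_add_compact : ∀ B ∈ compression P V,
    ∃ (c : ℂ) (K : H →L[ℂ] H), IsCompactOperator K ∧ B = c • P + K
  exists_compact_dense_range : ∃ K ∈ compression P V,
    IsSelfAdjoint K ∧ IsCompactOperator K ∧ K.range.topologicalClosure = P.range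

/-!
The theorem is a dichotomy on whether some compression `P V P`, with `P` a projection of infinite
rank, is finite-dimensional.

If it is, choose finitely many self-adjoint generators. An orthonormal sequence picked greedily in
the range of `P`, each term orthogonal to the images of the earlier ones under the generators,
makes all generators diagonal, and on a subsequence the diagonals converge
(`exists_orthonormal_diagonal`). Every generator is then a scalar plus a compact diagonal operator.
Either all these compact parts vanish along a further subsequence, which gives an anticlique, or
one of them has nonzero entries along a subsequence, which gives an obstruction
(`exists_anticlique_or_obstruction`).

If no such compression is finite-dimensional, an embedding `T : ℓ²(ℕ) → H` is built such that every
bounded operator on `ℓ²(ℕ)` is a weak limit of operators `T† A T` with `A ∈ V`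
(`exists_approximating_embedding`); the projection onto the range of `T` is then a clique. The
vectors `T eᵢ` are limits of a recursion that keeps finitely many vectors `v` and an
infinite-dimensional closed subspace `L` orthogonal to them. Each stage uses operators of `V` which
do not couple `v` with `L` and whose compression to `L` is nearly zero, and arranges that their
matrices on `v` fill the whole matrix algebra (`exists_isControlled`). All later changes happen
inside `L`, so these operators keep approximating the prescribed matrices in the limit.

The matrices are made to fill the algebra by raising the dimension of their span `S` one step at a
time (`exists_finrank_gram_lt`). If the span is proper, it misses some rank-one matrix `X`. Two
independent compressions to `L`, corrected by their asymptotic scalars, combine to an operator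
`A ∈ V` that vanishes on `v`, satisfies `⟪e, A e⟫ = 1` for some `e ∈ L`, and is asymptotically null
(`exists_isNullOn`). Moving the vectors by small multiples of `t e` adds a matrix `t Y + t² X` to the
span and perturbs `S` only in the direction `X`; for a suitable small `t` the dimension goes up.
-/

open Filter Topology
open scoped InnerProductSpace ComplexConjugate

/-! ### Infinite-dimensional closed subspaces -/

section

theorem finiteDimensional_range_of_map_ker {X Y Z : Type*} [AddCommGroup X] [Module ℂ X]
    [AddCommGroup Y] [Module ℂ Y] [AddCommGroup Z] [Module ℂ Z] [FiniteDimensional ℂ Z]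
    (f : X →ₗ[ℂ] Y) (g : X →ₗ[ℂ] Z) (h : FiniteDimensional ℂ ((LinearMap.ker g).map f)) :
    FiniteDimensional ℂ (LinearMap.range f) := by
  obtain ⟨C, hC⟩ := Submodule.exists_isCompl (LinearMap.ker g)
  have : FiniteDimensional ℂ C := by
    refine Module.Finite.of_injective (g.domRestrict C) ?_
    rw [← LinearMap.ker_eq_bot, LinearMap.ker_eq_bot']
    intro x hx
    have := (Submodule.disjoint_def.1 hC.disjoint) x (by simpa using hx) x.2
    exact Subtype.ext this
  rw [LinearMap.range_eq_map, ← hC.sup_eq_top, Submodule.map_sup]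
  infer_instance

end

section

variable {H : Type*} [NormedAddCommGroup H] [InnerProductSpace ℂ H]

/-- A closed subspace of infinite dimension. -/
def IsLarge (L : Submodule ℂ H) : Prop :=
  IsClosed (L : Set H) ∧ ¬ FiniteDimensional ℂ L

theorem not_finiteDimensional_inf_orthogonal {L : Submodule ℂ H} (hL : ¬ FiniteDimensional ℂ L)
    (F : Submodule ℂ H) [FiniteDimensional ℂ F] : ¬ FiniteDimensional ℂ ↥(L ⊓ Fᗮ) := by
  intro h
  apply hL
  have := finiteDimensional_range_of_map_ker L.subtype
    ((F.orthogonalProjectionOnto : H →ₗ[ℂ] F) ∘ₗ L.subtype) ?_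
  · rwa [Submodule.range_subtype] at this
  · refine Submodule.finiteDimensional_of_le (S₂ := L ⊓ Fᗮ) ?_
    rintro _ ⟨x, hx, rfl⟩
    refine ⟨x.2, ?_⟩
    simpa using hx

theorem IsLarge.inf_orthogonal {L : Submodule ℂ H} (hL : IsLarge L)
    (F : Submodule ℂ H) [FiniteDimensional ℂ F] : IsLarge (L ⊓ Fᗮ) :=
  ⟨hL.1.inter (Submodule.isClosed_orthogonal F), not_finiteDimensional_inf_orthogonal hL.2 F⟩

theorem exists_norm_eq_one_of_not_finiteDimensional {L : Submodule ℂ H}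
    (hL : ¬ FiniteDimensional ℂ L) : ∃ y ∈ L, ‖y‖ = 1 := by
  have : L ≠ ⊥ := by
    rintro rfl
    exact hL inferInstance
  obtain ⟨y, hy, h0⟩ := Submodule.exists_mem_ne_zero_of_ne_bot this
  exact ⟨((‖y‖ : ℂ)⁻¹) • y, L.smul_mem _ hy, by simp [norm_smul, h0]⟩

variable [CompleteSpace H]

/-- Finitely many operators are simultaneously diagonal, with convergent diagonals, along some
orthonormal sequence in a given infinite-dimensional subspace. -/
theorem exists_orthonormal_diagonal {L : Submodule ℂ H} (hL : ¬ FiniteDimensional ℂ L)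
    {ι : Type*} [Finite ι] (A : ι → H →L[ℂ] H) :
    ∃ e : ℕ → H, Orthonormal ℂ e ∧ (∀ n, e n ∈ L) ∧
      (∀ i m n, m ≠ n → ⟪e m, A i (e n)⟫_ℂ = 0) ∧
      ∃ a : ι → ℂ, ∀ i, Tendsto (fun n => ⟪e n, A i (e n)⟫_ℂ) atTop (𝓝 (a i)) := by
  have := Fintype.ofFinite ι
  classical
  obtain ⟨f, hf, hr⟩ := exists_seq_of_forall_finset_exists (fun y : H => y ∈ L ∧ ‖y‖ = 1)
    (fun x y => ⟪x, y⟫_ℂ = 0 ∧ ∀ i, ⟪x, A i y⟫_ℂ = 0 ∧ ⟪y, A i x⟫_ℂ = 0) (by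
      intro s _
      let G : Finset H := s ∪ (Finset.univ ×ˢ s).image (fun p : ι × H => A p.1 p.2) ∪
        (Finset.univ ×ˢ s).image (fun p : ι × H => ContinuousLinearMap.adjoint (A p.1) p.2)
      let F := Submodule.span ℂ (G : Set H)
      have : FiniteDimensional ℂ F := FiniteDimensional.span_finset ℂ G
      obtain ⟨y, hy, hy1⟩ :=
        exists_norm_eq_one_of_not_finiteDimensional (not_finiteDimensional_inf_orthogonal hL F)
      have key : ∀ z ∈ G, ⟪z, y⟫_ℂ = 0 := fun z hz => hy.2 z (Submodule.subset_span hz)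
      refine ⟨y, ⟨hy.1, hy1⟩, fun x hx => ⟨key x ?_, fun i => ⟨?_, ?_⟩⟩⟩
      · simp [G, hx]
      · rw [← ContinuousLinearMap.adjoint_inner_left]
        apply key
        simp only [G, Finset.mem_union, Finset.mem_image]
        exact Or.inr ⟨(i, x), by simp [hx], rfl⟩
      · rw [← inner_conj_symm, key _ ?_, map_zero]
        simp only [G, Finset.mem_union, Finset.mem_image]
        exact Or.inl (Or.inr ⟨(i, x), by simp [hx], rfl⟩))
  have hoff : ∀ m n, m ≠ n → ⟪f m, f n⟫_ℂ = 0 ∧ ∀ i, ⟪f m, A i (f n)⟫_ℂ = 0 := by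
    intro m n hmn
    rcases lt_or_gt_of_ne hmn with h | h
    · exact ⟨(hr _ _ h).1, fun i => ((hr _ _ h).2 i).1⟩
    · exact ⟨by rw [← inner_conj_symm, (hr _ _ h).1, map_zero], fun i => ((hr _ _ h).2 i).2⟩
  let u : ℕ → ι → ℂ := fun n i => ⟪f n, A i (f n)⟫_ℂ
  have hu : ∀ n, u n ∈ Metric.closedBall (0 : ι → ℂ) (∑ i, ‖A i‖) := by
    intro n
    rw [mem_closedBall_zero_iff, pi_norm_le_iff_of_nonneg (Finset.sum_nonneg fun _ _ => norm_nonneg _)]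
    intro i
    calc ‖u n i‖ ≤ ‖f n‖ * ‖A i (f n)‖ := norm_inner_le_norm _ _
      _ ≤ ‖A i‖ := by
        rw [(hf n).2, one_mul]
        simpa [(hf n).2] using (A i).le_opNorm (f n)
      _ ≤ _ := Finset.single_le_sum (f := fun i => ‖A i‖) (fun _ _ => norm_nonneg _)
        (Finset.mem_univ i)
  obtain ⟨a, -, φ, hφ, ha⟩ := tendsto_subseq_of_bounded Metric.isBounded_closedBall hu
  refine ⟨f ∘ φ, ⟨fun n => (hf _).2, fun m n hmn => (hoff _ _ (hφ.injective.ne hmn)).1⟩,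
    fun n => (hf _).1, fun i m n hmn => (hoff _ _ (hφ.injective.ne hmn)).2 i, a, fun i => ?_⟩
  exact (tendsto_pi_nhds.1 ha) i

end

/-! ### Diagonal operators on the sequence space -/

section

/-- The Hilbert space `ℓ²(ℕ)`. -/
abbrev EllTwo : Type := lp (fun _ : ℕ => ℂ) 2

/-- The standard unit vectors of `ℓ²(ℕ)`. -/
noncomputable def unitVec (n : ℕ) : EllTwo := lp.single 2 n 1

theorem inner_unitVec_left (n : ℕ) (x : EllTwo) : ⟪unitVec n, x⟫_ℂ = x n := by
  simp [unitVec, lp.inner_single_left]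

theorem norm_unitVec (n : ℕ) : ‖unitVec n‖ = 1 := by
  simp [unitVec, lp.norm_single]

theorem unitVec_apply (n m : ℕ) : unitVec n m = if m = n then 1 else 0 := by
  simp [unitVec, lp.single_apply, Pi.single_apply]

theorem hasSum_unitVec (x : EllTwo) : HasSum (fun n => x n • unitVec n) x := by
  have := lp.hasSum_single (p := 2) (by simp) x
  refine this.congr_fun fun n => ?_
  rw [unitVec, ← lp.single_smul, smul_eq_mul, mul_one]

theorem norm_le_mul_of_forall_apply {x y : EllTwo} {c : ℝ} (hc : 0 ≤ c)
    (h : ∀ n, ‖y n‖ ≤ c * ‖x n‖) : ‖y‖ ≤ c * ‖x‖ := by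
  have := lp.norm_mono (p := 2) (by simp) (x := y) (y := (c : ℂ) • x)
    (fun n => by
      rw [lp.coeFn_smul, Pi.smul_apply, norm_smul, Complex.norm_real, Real.norm_of_nonneg hc]
      exact h n)
  rwa [norm_smul, Complex.norm_real, Real.norm_of_nonneg hc] at this

theorem exists_norm_diagonal_le {D : EllTwo →L[ℂ] EllTwo} {d : ℕ → ℂ}
    (hD : ∀ x n, D x n = d n * x n) (hd : Tendsto d atTop (𝓝 0)) {η : ℝ} (hη : 0 < η) :
    ∃ N, ∀ x : EllTwo, (∀ n < N, x n = 0) → ‖D x‖ ≤ η * ‖x‖ := by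
  obtain ⟨N, hN⟩ := (Metric.tendsto_atTop.1 hd) η hη
  refine ⟨N, fun x hx => norm_le_mul_of_forall_apply hη.le fun n => ?_⟩
  rw [hD, norm_mul]
  rcases lt_or_ge n N with h | h
  · simp [hx n h]
  · gcongr
    simpa using (hN n h).le

/-- The projection of `ℓ²(ℕ)` onto the span of the first `N` unit vectors. -/
noncomputable def truncation (N : ℕ) : EllTwo →L[ℂ] EllTwo :=
  ∑ n ∈ Finset.range N, (innerSL ℂ (unitVec n)).smulRight (unitVec n)

theorem truncation_apply (N : ℕ) (x : EllTwo) :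
    truncation N x = ∑ n ∈ Finset.range N, x n • unitVec n := by
  simp [truncation, inner_unitVec_left]

theorem truncation_apply_apply (N : ℕ) (x : EllTwo) (n : ℕ) :
    truncation N x n = if n < N then x n else 0 := by
  rw [← inner_unitVec_left, truncation_apply, inner_sum]
  simp [inner_smul_right, inner_unitVec_left, unitVec_apply]

theorem tendsto_truncation (x : EllTwo) : Tendsto (fun N => truncation N x) atTop (𝓝 x) := by
  simp_rw [truncation_apply]
  exact (hasSum_unitVec x).tendsto_sum_nat

theorem isCompactOperator_truncation (N : ℕ) : IsCompactOperator (truncation N) := by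
  refine (compactOperator (RingHom.id ℂ) EllTwo EllTwo).sum_mem (f := fun n =>
    (((innerSL ℂ (unitVec n)).smulRight (unitVec n) : EllTwo →L[ℂ] EllTwo))) fun n _ => ?_
  have : IsCompactOperator (innerSL ℂ (unitVec n) : EllTwo →L[ℂ] ℂ) :=
    isCompactOperator_of_locallyCompactSpace_dom _
  exact this.clm_comp (ContinuousLinearMap.toSpanSingleton ℂ (unitVec n))

theorem isCompactOperator_diagonal {D : EllTwo →L[ℂ] EllTwo} {d : ℕ → ℂ}
    (hD : ∀ x n, D x n = d n * x n) (hd : Tendsto d atTop (𝓝 0)) : IsCompactOperator D := by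
  refine isCompactOperator_of_tendsto (l := atTop) (F := fun N => D ∘L truncation N) ?_
    (Eventually.of_forall fun N => (isCompactOperator_truncation N).clm_comp D)
  rw [Metric.tendsto_atTop]
  intro ε hε
  obtain ⟨N, hN⟩ := exists_norm_diagonal_le hD hd (half_pos hε)
  refine ⟨N, fun k hk => lt_of_le_of_lt ?_ (half_lt_self hε)⟩
  rw [dist_comm, dist_eq_norm]
  refine ContinuousLinearMap.opNorm_le_bound _ (half_pos hε).le fun x => ?_
  have h1 : (D - D ∘L truncation k) x = D (x - truncation k x) := by simp
  rw [h1]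
  refine (hN _ fun n hn => ?_).trans ?_
  · simp [truncation_apply_apply, hn.trans_le hk]
  · gcongr
    rw [← one_mul ‖x‖]
    refine norm_le_mul_of_forall_apply zero_le_one fun n => ?_
    simp only [lp.coeFn_sub, Pi.sub_apply, truncation_apply_apply]
    split_ifs <;> simp

end

/-! ### Diagonal compressions -/

section

variable {H : Type*} [NormedAddCommGroup H] [InnerProductSpace ℂ H]

theorem not_finiteDimensional_range {T : EllTwo →ₗ[ℂ] H} (hT : Function.Injective T) :
    ¬ FiniteDimensional ℂ (LinearMap.range T) := by
  intro h
  have : FiniteDimensional ℂ EllTwo :=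
    Module.Finite.of_injective T.rangeRestrict (by
      intro x y hxy
      exact hT (congrArg Subtype.val hxy))
  have hli : LinearIndependent ℂ unitVec := by
    refine Orthonormal.linearIndependent ⟨norm_unitVec, fun m n hmn => ?_⟩
    simp [inner_unitVec_left, unitVec_apply, hmn]
  exact not_finite_iff_infinite.2 inferInstance hli.finite

theorem isLarge_range {T : EllTwo →L[ℂ] H} {c : ℝ} (hc : 0 < c) (hT : ∀ x, c * ‖x‖ ≤ ‖T x‖) :
    IsLarge T.range := by
  have h : AntilipschitzWith (Real.toNNReal c⁻¹) T := by
    refine ContinuousLinearMap.antilipschitz_of_bound T fun x => ?_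
    rw [Real.coe_toNNReal _ (inv_nonneg.2 hc.le), ← div_eq_inv_mul, le_div_iff₀ hc, mul_comm]
    exact hT x
  refine ⟨?_, not_finiteDimensional_range h.injective⟩
  exact h.isClosed_range T.uniformContinuous

variable [CompleteSpace H]

/-- The isometry from `ℓ²(ℕ)` sending the unit vectors to a given orthonormal sequence. -/
noncomputable def seqIsometry {e : ℕ → H} (he : Orthonormal ℂ e) : EllTwo →ₗᵢ[ℂ] H :=
  he.orthogonalFamily.linearIsometry

theorem seqIsometry_unitVec {e : ℕ → H} (he : Orthonormal ℂ e) (n : ℕ) :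
    seqIsometry he (unitVec n) = e n := by
  unfold seqIsometry unitVec
  rw [OrthogonalFamily.linearIsometry_apply_single]
  simp

theorem hasSum_seqIsometry {e : ℕ → H} (he : Orthonormal ℂ e) (x : EllTwo) :
    HasSum (fun n => x n • e n) (seqIsometry he x) :=
  he.orthogonalFamily.hasSum_linearIsometry x

theorem seqIsometry_mem {e : ℕ → H} (he : Orthonormal ℂ e) {L : Submodule ℂ H}
    (hL : IsClosed (L : Set H)) (h : ∀ n, e n ∈ L) (x : EllTwo) : seqIsometry he x ∈ L :=
  hL.mem_of_tendsto (hasSum_seqIsometry he x)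
    (Eventually.of_forall fun _ => L.sum_mem fun n _ => L.smul_mem _ (h n))

theorem inner_apply_seqIsometry {e : ℕ → H} (he : Orthonormal ℂ e) {A : H →L[ℂ] H}
    (hA : ∀ m n, m ≠ n → ⟪e m, A (e n)⟫_ℂ = 0) (x : EllTwo) (n : ℕ) :
    ⟪e n, A (seqIsometry he x)⟫_ℂ = ⟪e n, A (e n)⟫_ℂ * x n := by
  have h1 := ((innerSL ℂ (e n)) ∘L A).hasSum (hasSum_seqIsometry he x)
  refine h1.unique ?_
  convert hasSum_single n ?_ using 1
  · simp [mul_comm]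
  · intro m hm
    simp [hA n m hm.symm]

theorem adjoint_seqIsometry_comp_apply {e : ℕ → H} (he : Orthonormal ℂ e) {C : H →L[ℂ] H}
    (hC : ∀ m n, m ≠ n → ⟪e m, C (e n)⟫_ℂ = 0) (x : EllTwo) (n : ℕ) :
    (ContinuousLinearMap.adjoint (seqIsometry he).toContinuousLinearMap ∘L C ∘L
      (seqIsometry he).toContinuousLinearMap) x n = ⟪e n, C (e n)⟫_ℂ * x n := by
  let U := (seqIsometry he).toContinuousLinearMap
  calc (ContinuousLinearMap.adjoint U ∘L C ∘L U) x n
      = ⟪unitVec n, ContinuousLinearMap.adjoint U (C (U x))⟫_ℂ := (inner_unitVec_left n _).symm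
    _ = ⟪U (unitVec n), C (U x)⟫_ℂ := ContinuousLinearMap.adjoint_inner_right U _ _
    _ = _ := by
      change ⟪seqIsometry he (unitVec n), C (seqIsometry he x)⟫_ℂ = _
      rw [seqIsometry_unitVec, inner_apply_seqIsometry he hC]

end

/-! ### Operators that are asymptotically null on a subspace -/

section

variable {H : Type*} [NormedAddCommGroup H] [InnerProductSpace ℂ H]

/-- The sesquilinear form of `A` on `L` becomes arbitrarily small off finite-dimensional
subspaces. For closed `L` this says that the compression of `A` to `L` is compact. -/
def IsNullOn (A : H →L[ℂ] H) (L : Submodule ℂ H) : Prop :=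
  ∀ η : ℝ, 0 < η → ∃ F : Submodule ℂ H, FiniteDimensional ℂ F ∧
    ∀ x ∈ L ⊓ Fᗮ, ∀ y ∈ L ⊓ Fᗮ, ‖⟪x, A y⟫_ℂ‖ ≤ η * ‖x‖ * ‖y‖

theorem IsNullOn.mono {A : H →L[ℂ] H} {L L' : Submodule ℂ H} (h : IsNullOn A L) (hL : L' ≤ L) :
    IsNullOn A L' := by
  intro η hη
  obtain ⟨F, hF, h⟩ := h η hη
  exact ⟨F, hF, fun x hx y hy => h x ⟨hL hx.1, hx.2⟩ y ⟨hL hy.1, hy.2⟩⟩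

theorem IsNullOn.zero (L : Submodule ℂ H) : IsNullOn (0 : H →L[ℂ] H) L :=
  fun η hη => ⟨⊥, inferInstance, fun x _ y _ => by simp; positivity⟩

theorem IsNullOn.add {A B : H →L[ℂ] H} {L : Submodule ℂ H} (hA : IsNullOn A L)
    (hB : IsNullOn B L) : IsNullOn (A + B) L := by
  intro η hη
  obtain ⟨F, hF, h⟩ := hA (η / 2) (half_pos hη)
  obtain ⟨G, hG, h'⟩ := hB (η / 2) (half_pos hη)
  refine ⟨F ⊔ G, inferInstance, fun x hx y hy => ?_⟩
  rw [← Submodule.inf_orthogonal] at hx hy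
  have h1 := h x ⟨hx.1, hx.2.1⟩ y ⟨hy.1, hy.2.1⟩
  have h2 := h' x ⟨hx.1, hx.2.2⟩ y ⟨hy.1, hy.2.2⟩
  rw [add_apply, inner_add_right]
  refine (norm_add_le _ _).trans ?_
  linarith

theorem IsNullOn.smul {A : H →L[ℂ] H} {L : Submodule ℂ H} (hA : IsNullOn A L) (c : ℂ) :
    IsNullOn (c • A) L := by
  intro η hη
  obtain ⟨F, hF, h⟩ := hA (η / (‖c‖ + 1)) (by positivity)
  refine ⟨F, hF, fun x hx y hy => ?_⟩
  rw [smul_apply, inner_smul_right, norm_mul]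
  calc ‖c‖ * ‖⟪x, A y⟫_ℂ‖ ≤ (‖c‖ + 1) * (η / (‖c‖ + 1) * ‖x‖ * ‖y‖) := by
        gcongr
        · linarith
        · exact h x hx y hy
    _ = η * ‖x‖ * ‖y‖ := by field_simp

theorem exists_inner_self_ne_zero {L : Submodule ℂ H} [L.HasOrthogonalProjection] {A : H →L[ℂ] H}
    (hA : L.starProjection * A * L.starProjection ≠ 0) : ∃ e ∈ L, ⟪e, A e⟫_ℂ ≠ 0 := by
  by_contra! h
  apply hA
  have : ((L.starProjection * A * L.starProjection : H →L[ℂ] H) : H →ₗ[ℂ] H) = 0 := by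
    refine inner_map_self_eq_zero _ |>.1 fun x => ?_
    have := h (L.starProjection x) (Submodule.starProjection_apply_mem L x)
    rw [← inner_conj_symm, map_eq_zero]
    simpa [Submodule.inner_starProjection_left_eq_right] using this
  ext x
  exact congrArg (fun f : H →ₗ[ℂ] H => f x) this

variable [CompleteSpace H]

theorem isNullOn_range_seqIsometry {e : ℕ → H} (he : Orthonormal ℂ e) {A : H →L[ℂ] H}
    (hA : ∀ m n, m ≠ n → ⟪e m, A (e n)⟫_ℂ = 0)
    (h0 : Tendsto (fun n => ⟪e n, A (e n)⟫_ℂ) atTop (𝓝 0)) :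
    IsNullOn A (seqIsometry he).toContinuousLinearMap.range := by
  intro η hη
  let U := (seqIsometry he).toContinuousLinearMap
  let D : EllTwo →L[ℂ] EllTwo := ContinuousLinearMap.adjoint U ∘L A ∘L U
  obtain ⟨N, hN⟩ := exists_norm_diagonal_le (D := D) (adjoint_seqIsometry_comp_apply he hA) h0 hη
  refine ⟨Submodule.span ℂ (e '' Set.Iio N),
    FiniteDimensional.span_of_finite ℂ ((Set.finite_Iio N).image e), ?_⟩
  rintro _ ⟨⟨x, rfl⟩, _⟩ _ ⟨⟨y, rfl⟩, hy⟩
  have h1 : ⟪U x, A (U y)⟫_ℂ = ⟪x, D y⟫_ℂ := (ContinuousLinearMap.adjoint_inner_right U _ _).symm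
  have hx : ‖U x‖ = ‖x‖ := (seqIsometry he).norm_map x
  have hy' : ‖U y‖ = ‖y‖ := (seqIsometry he).norm_map y
  change ‖⟪U x, A (U y)⟫_ℂ‖ ≤ η * ‖U x‖ * ‖U y‖
  rw [h1, hx, hy']
  calc ‖⟪x, D y⟫_ℂ‖ ≤ ‖x‖ * ‖D y‖ := norm_inner_le_norm _ _
    _ ≤ ‖x‖ * (η * ‖y‖) := by
      gcongr
      refine hN y fun n hn => ?_
      have := hy (e n) (Submodule.subset_span ⟨n, hn, rfl⟩)
      rw [← seqIsometry_unitVec he] at this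
      rw [← inner_unitVec_left, ← (seqIsometry he).inner_map_map]
      exact this
    _ = _ := by ring

/-- If the compression of `V` to `L` is infinite-dimensional, then some operator in `V` vanishes on
a given finite family, has a nonzero compression to `L`, and is asymptotically null on a large
subspace of `L`. Such an operator is a combination of two operators with independent compressions:
one cancels the asymptotic scalar of the other. -/
theorem exists_isNullOn {V : Submodule ℂ (H →L[ℂ] H)} {L : Submodule ℂ H}
    [L.HasOrthogonalProjection] (hL : IsLarge L)
    (hV : ¬ FiniteDimensional ℂ (compression L.starProjection V))
    {ι : Type*} [Finite ι] (v : ι → H) :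
    ∃ A ∈ V, (∀ i j, ⟪v i, A (v j)⟫_ℂ = 0) ∧ (∃ e ∈ L, ⟪e, A e⟫_ℂ = 1) ∧
      ∃ L' ≤ L, IsLarge L' ∧ IsNullOn A L' := by
  have := Fintype.ofFinite ι
  let f : V →ₗ[ℂ] (H →L[ℂ] H) :=
    (LinearMap.mulLeftRight ℂ (L.starProjection, L.starProjection)) ∘ₗ V.subtype
  let g : V →ₗ[ℂ] (ι → ι → ℂ) :=
    { toFun := fun A i j => ⟪v i, A.1 (v j)⟫_ℂ
      map_add' := fun A B => by ext; simp
      map_smul' := fun c A => by ext; simp }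
  have hf : LinearMap.range f = compression L.starProjection V := by
    rw [LinearMap.range_comp, Submodule.range_subtype, compression]
  have hinf : ¬ FiniteDimensional ℂ ((LinearMap.ker g).map f) := fun h =>
    hV (hf ▸ finiteDimensional_range_of_map_ker f g h)
  have hrank : ∃ B : Fin 2 → (LinearMap.ker g).map f, LinearIndependent ℂ B := by
    have hfin : Infinite (Module.Basis.ofVectorSpaceIndex ℂ ((LinearMap.ker g).map f)) := by
      by_contra h
      rw [not_infinite_iff_finite] at h
      exact hinf (Module.Finite.of_basis (Module.Basis.ofVectorSpace ℂ _))
    exact ⟨_, (Module.Basis.ofVectorSpace ℂ _).linearIndependent.comp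
      (fun i : Fin 2 => Infinite.natEmbedding _ (i : ℕ))
      ((Infinite.natEmbedding _).injective.comp Fin.val_injective)⟩
  obtain ⟨B, hB⟩ := hrank
  choose A hAker hAB using fun i => (B i).2
  obtain ⟨e, he, heL, hoff, a, ha⟩ :=
    exists_orthonormal_diagonal hL.2 (fun i : Fin 2 => (A i : H →L[ℂ] H))
  obtain ⟨c, hc0, hc⟩ : ∃ c : Fin 2 → ℂ, c ≠ 0 ∧ c 0 * a 0 + c 1 * a 1 = 0 := by
    by_cases h : a 0 = 0
    · exact ⟨![1, 0], fun h => by simpa using congrFun h 0, by simp [h]⟩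
    · exact ⟨![a 1, -a 0], fun h' => h (by simpa using congrFun h' 1), by simp; ring⟩
  let C : V := c 0 • A 0 + c 1 • A 1
  have hCker : g C = 0 := by
    have := hAker 0
    have := hAker 1
    simp_all [C]
  have hCf : f C ≠ 0 := by
    intro h
    apply hc0
    have h2 : ∑ i, c i • B i = 0 := by
      ext1
      rw [Fin.sum_univ_two]
      simpa [C, ← hAB] using h
    exact funext fun i => Fintype.linearIndependent_iff.1 hB c h2 i
  obtain ⟨x, hx, hx0⟩ := exists_inner_self_ne_zero (L := L) (A := C.1) hCf
  let s : ℂ := ⟪x, C.1 x⟫_ℂ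
  refine ⟨s⁻¹ • C.1, V.smul_mem _ C.2, fun i j => ?_, ?_, _, ?_,
    isLarge_range (T := (seqIsometry he).toContinuousLinearMap) one_pos (fun x => by simp),
    (isNullOn_range_seqIsometry he ?_ ?_).smul _⟩
  · have := congrFun (congrFun hCker i) j
    simp only [g, LinearMap.coe_mk, AddHom.coe_mk, Pi.zero_apply] at this
    simp [this]
  · exact ⟨x, hx, by simp [s, hx0]⟩
  · rintro _ ⟨y, rfl⟩
    exact seqIsometry_mem he hL.1 heL y
  · intro m n hmn
    simp [C, hoff _ m n hmn]
  · rw [← hc]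
    refine (((ha 0).const_mul (c 0)).add ((ha 1).const_mul (c 1))).congr fun n => ?_
    simp [C]

end

/-! ### Linear algebra of rank growth -/

section

/-- By polarization, the matrices `conj (x i) * x j` span all matrices. -/
theorem exists_outer_notMem {ι : Type*} [Finite ι] {S : Submodule ℂ (ι → ι → ℂ)} (hS : S ≠ ⊤) :
    ∃ x : ι → ℂ, (fun i j => conj (x i) * x j) ∉ S := by
  have := Fintype.ofFinite ι
  classical
  by_contra! h
  have hpol : ∀ x y : ι → ℂ, (fun i j => conj (x i) * y j) ∈ S := by
    intro x y
    have h1 := S.sub_mem (S.sub_mem (h (x + y)) (h (x - y)))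
      (S.smul_mem Complex.I (S.sub_mem (h (x + Complex.I • y)) (h (x - Complex.I • y))))
    convert S.smul_mem (1 / 4) h1 using 1
    ext i j
    simp only [Pi.add_apply, Pi.sub_apply, Pi.smul_apply, smul_eq_mul, map_add, map_sub, map_mul,
      Complex.conj_I]
    linear_combination (1 / 2 * conj (x i) * y j - 1 / 2 * conj (y i) * x j) * Complex.I_sq
  apply hS
  rw [eq_top_iff]
  rintro f -
  have h2 : f = ∑ k, ∑ l, f k l •
      (fun i j => conj ((Pi.single k 1 : ι → ℂ) i) * (Pi.single l 1 : ι → ℂ) j) := by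
    ext i j
    simp [Finset.sum_apply, Pi.single_apply, apply_ite]
  rw [h2]
  exact S.sum_mem fun k _ => S.sum_mem fun l _ => S.smul_mem _ (hpol _ _)

/-- Perturbing a subspace `S` along a direction `X ∉ S` and adjoining `t Y + t ^ 2 X` raises the
dimension for some small `t`: failure at three values of `t` would give one quadratic polynomial
three roots. -/
theorem exists_finrank_lt_of_perturbation {M : Type*} [AddCommGroup M] [Module ℂ M]
    [FiniteDimensional ℂ M] {S : Submodule ℂ M} {X : M} (hX : X ∉ S) (Y : M) (β : S →ₗ[ℂ] ℂ)
    {δ : ℝ} (hδ : 0 < δ) : ∃ t : ℝ, 0 < t ∧ t ≤ δ ∧ ∀ S' : Submodule ℂ M,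
      (∀ s : S, (s : M) + ((t : ℂ) ^ 2 * β s) • X ∈ S') → (t : ℂ) • Y + ((t : ℂ) ^ 2) • X ∈ S' →
      Module.finrank ℂ S < Module.finrank ℂ S' := by
  have hXS : ∀ (c : ℂ) (s : S), c • X = s → c = 0 ∧ s = 0 := by
    intro c s h
    have hc : c = 0 := by
      by_contra hc
      apply hX
      rw [← inv_smul_smul₀ hc X, h]
      exact S.smul_mem _ s.2
    exact ⟨hc, Subtype.ext (by rw [← h, hc, zero_smul, Submodule.coe_zero])⟩
  obtain ⟨t, ht0, htδ, ht⟩ : ∃ t : ℝ, 0 < t ∧ t ≤ δ ∧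
      ∀ s : S, Y + (t : ℂ) • X ≠ (s : M) + ((t : ℂ) ^ 2 * β s) • X := by
    by_contra! h
    obtain ⟨s₁, h₁⟩ := h δ hδ le_rfl
    obtain ⟨s₂, h₂⟩ := h (δ / 2) (by positivity) (by linarith)
    obtain ⟨s₃, h₃⟩ := h (δ / 4) (by positivity) (by linarith)
    -- Differences of the three equations put multiples of `X` into `S`, so the coefficients vanish
    -- and the three elements of `S` coincide.
    have e₁ := hXS ((δ : ℂ) - (δ / 2 : ℝ) - (δ : ℂ) ^ 2 * β s₁ + ((δ / 2 : ℝ) : ℂ) ^ 2 * β s₂)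
      (s₁ - s₂) (by
        rw [Submodule.coe_sub]
        linear_combination (norm := module) h₁ - h₂)
    have e₂ := hXS ((δ : ℂ) - (δ / 4 : ℝ) - (δ : ℂ) ^ 2 * β s₁ + ((δ / 4 : ℝ) : ℂ) ^ 2 * β s₃)
      (s₁ - s₃) (by
        rw [Submodule.coe_sub]
        linear_combination (norm := module) h₁ - h₃)
    obtain ⟨e₁, e₁'⟩ := e₁
    obtain ⟨e₂, e₂'⟩ := e₂
    rw [sub_eq_zero] at e₁' e₂'
    rw [← e₁'] at e₁
    rw [← e₂'] at e₂
    push_cast at e₁ e₂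
    have hδ' : (δ : ℂ) ≠ 0 := by exact_mod_cast hδ.ne'
    have : (δ : ℂ) = 0 := by linear_combination 8 * e₂ - 10 * e₁
    exact hδ' this
  refine ⟨t, ht0, htδ, fun S' h1 h2 => ?_⟩
  have htc : (t : ℂ) ≠ 0 := by exact_mod_cast ht0.ne'
  let Θ : S × ℂ →ₗ[ℂ] M :=
    (S.subtype + ((t : ℂ) ^ 2 • β).smulRight X).coprod
      (LinearMap.toSpanSingleton ℂ M ((t : ℂ) • Y + ((t : ℂ) ^ 2) • X))
  have hΘ : ∀ p, Θ p = ((p.1 : M) + ((t : ℂ) ^ 2 * β p.1) • X) +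
      p.2 • ((t : ℂ) • Y + ((t : ℂ) ^ 2) • X) := fun p => by simp [Θ]
  have hinj : Function.Injective Θ := by
    rw [← LinearMap.ker_eq_bot, LinearMap.ker_eq_bot']
    rintro ⟨s, c⟩ h
    rw [hΘ] at h
    simp only at h
    by_cases hc : c = 0
    · subst hc
      obtain ⟨-, hs⟩ := hXS (-((t : ℂ) ^ 2 * β s)) s (by
        linear_combination (norm := module) -h)
      rw [hs]; rfl
    · exfalso
      have hc' : c ≠ 0 := hc
      refine ht (-(c * t)⁻¹ • s) ?_
      have : (c * t) • (Y + (t : ℂ) • X - ((-(c * t)⁻¹ • s : S) : M) -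
          ((t : ℂ) ^ 2 * β (-(c * t)⁻¹ • s)) • X) = 0 := by
        simp only [← h, map_smul, Submodule.coe_smul, smul_eq_mul]
        match_scalars <;> field_simp
        ring
      have := (smul_eq_zero.1 this).resolve_left (mul_ne_zero hc htc)
      rw [sub_sub, sub_eq_zero] at this
      exact this
  have hmem : ∀ p, Θ p ∈ S' := fun p => by
    rw [hΘ]
    exact S'.add_mem (h1 _) (S'.smul_mem _ h2)
  have := LinearMap.finrank_le_finrank_of_injective (f := Θ.codRestrict S' hmem)
    (fun x y hxy => hinj (congrArg Subtype.val hxy))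
  rw [Module.finrank_prod, Module.finrank_self] at this
  omega

end

/-! ### Admissible operators and their Gram matrices -/

section

variable {H : Type*} [NormedAddCommGroup H] [InnerProductSpace ℂ H] {ι : Type*}

/-- The matrix of the sesquilinear form of an operator on a family of vectors. -/
noncomputable def gram (v : ι → H) : (H →L[ℂ] H) →ₗ[ℂ] (ι → ι → ℂ) where
  toFun B i j := ⟪v i, B (v j)⟫_ℂ
  map_add' A B := by ext; simp
  map_smul' c A := by ext; simp

theorem gram_apply (v : ι → H) (B : H →L[ℂ] H) (i j : ι) : gram v B i j = ⟪v i, B (v j)⟫_ℂ := rfl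

/-- The operators in `V` that do not couple the family `v` with the subspace `L` and are
asymptotically null on `L`. -/
def admissible (V : Submodule ℂ (H →L[ℂ] H)) (v : ι → H) (L : Submodule ℂ H) :
    Submodule ℂ (H →L[ℂ] H) where
  carrier := {B | B ∈ V ∧ (∀ i, ∀ l ∈ L, ⟪l, B (v i)⟫_ℂ = 0 ∧ ⟪v i, B l⟫_ℂ = 0) ∧ IsNullOn B L}
  add_mem' {A B} hA hB := ⟨V.add_mem hA.1 hB.1, fun i l hl => by
    simp [hA.2.1 i l hl, hB.2.1 i l hl], hA.2.2.add hB.2.2⟩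
  zero_mem' := ⟨V.zero_mem, by simp, IsNullOn.zero L⟩
  smul_mem' c A hA := ⟨V.smul_mem c hA.1, fun i l hl => by
    simp [hA.2.1 i l hl], hA.2.2.smul c⟩

/-- `(v', L')` refines `(v, L)`: the vectors have moved by at most `ε` inside `L`, and `L'` is a
large subspace of `L` orthogonal to the new vectors. -/
structure Refines (ε : ℝ) (v : ι → H) (L : Submodule ℂ H) (v' : ι → H) (L' : Submodule ℂ H) :
    Prop where
  le : L' ≤ L
  isLarge : IsLarge L'
  sub_mem : ∀ i, v' i - v i ∈ L
  norm_sub_le : ∀ i, ‖v' i - v i‖ ≤ ε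
  orthogonal : ∀ i, ∀ l ∈ L', ⟪l, v' i⟫_ℂ = 0

theorem Refines.trans {ε ε' : ℝ} {v v' v'' : ι → H} {L L' L'' : Submodule ℂ H}
    (h : Refines ε v L v' L') (h' : Refines ε' v' L' v'' L'') :
    Refines (ε + ε') v L v'' L'' where
  le := h'.le.trans h.le
  isLarge := h'.isLarge
  sub_mem i := by
    simpa using L.add_mem (h.le (h'.sub_mem i)) (h.sub_mem i)
  norm_sub_le i := by
    have := norm_add_le (v' i - v i) (v'' i - v' i)
    rw [add_comm, sub_add_sub_cancel] at this
    linarith [h.norm_sub_le i, h'.norm_sub_le i]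
  orthogonal := h'.orthogonal

variable [CompleteSpace H]

/-- If the Gram matrices of the admissible operators do not fill the matrix algebra, an arbitrarily
small refinement makes them span a space of larger dimension. -/
theorem exists_finrank_gram_lt {V : Submodule ℂ (H →L[ℂ] H)}
    (hV : ∀ (L : Submodule ℂ H) [L.HasOrthogonalProjection], IsLarge L →
      ¬ FiniteDimensional ℂ (compression L.starProjection V))
    [Finite ι] {v : ι → H} {L : Submodule ℂ H} (hL : IsLarge L)
    (hv : ∀ i, ∀ l ∈ L, ⟪l, v i⟫_ℂ = 0) (hS : (admissible V v L).map (gram v) ≠ ⊤)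
    {ε : ℝ} (hε : 0 < ε) :
    ∃ (v' : ι → H) (L' : Submodule ℂ H), Refines ε v L v' L' ∧
      Module.finrank ℂ ((admissible V v L).map (gram v)) <
        Module.finrank ℂ ((admissible V v' L').map (gram v')) := by
  have := Fintype.ofFinite ι
  have : CompleteSpace L := hL.1.completeSpace_coe
  set S := (admissible V v L).map (gram v)
  obtain ⟨x, hx⟩ := exists_outer_notMem hS
  obtain ⟨A, hAV, hA0, ⟨e, heL, he⟩, L₁, hL₁, hL₁', hnull⟩ := exists_isNullOn hL (hV L hL) v
  obtain ⟨τ, hτ⟩ := LinearMap.exists_rightInverse_of_surjective _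
    (LinearMap.range_eq_top.2 ((gram v).submoduleMap_surjective (admissible V v L)))
  let σ : S →ₗ[ℂ] (H →L[ℂ] H) := (admissible V v L).subtype ∘ₗ τ
  have hσ : ∀ s, σ s ∈ admissible V v L := fun s => (τ s).2
  have hσg : ∀ s, gram v (σ s) = s := fun s => congrArg Subtype.val (LinearMap.congr_fun hτ s)
  let b := Module.finBasis ℂ S
  let β : S →ₗ[ℂ] ℂ :=
    { toFun := fun s => ⟪e, σ s e⟫_ℂ
      map_add' := fun s s' => by simp
      map_smul' := fun c s => by simp }
  let Y : ι → ι → ℂ := fun i j => conj (x i) * ⟪e, A (v j)⟫_ℂ + x j * ⟪v i, A e⟫_ℂ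
  have hκ : 0 < ∑ i, ‖x i‖ * ‖e‖ + 1 := by positivity
  obtain ⟨t, ht0, htδ, ht⟩ := exists_finrank_lt_of_perturbation hx Y β (div_pos hε hκ)
  -- The new subspace has to be orthogonal to every vector that the perturbed family,
  -- `A` and the chosen lifts `σ` can couple with.
  let G : Set H := {e, A e, ContinuousLinearMap.adjoint A e} ∪
    Set.range (fun i => A (v i)) ∪ Set.range (fun i => ContinuousLinearMap.adjoint A (v i)) ∪
    Set.range (fun k => σ (b k) e) ∪ Set.range (fun k => ContinuousLinearMap.adjoint (σ (b k)) e)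
  have hG : G.Finite := by
    refine (((Set.Finite.union ?_ (Set.finite_range _)).union (Set.finite_range _)).union
      (Set.finite_range _)).union (Set.finite_range _)
    simp
  have : FiniteDimensional ℂ (Submodule.span ℂ G) := FiniteDimensional.span_of_finite ℂ hG
  let L' := L₁ ⊓ (Submodule.span ℂ G)ᗮ
  have hGl : ∀ l ∈ L', ∀ z ∈ G, ⟪z, l⟫_ℂ = 0 := fun l hl z hz =>
    hl.2 z (Submodule.subset_span hz)
  have hGl' : ∀ l ∈ L', ∀ z ∈ G, ⟪l, z⟫_ℂ = 0 := fun l hl z hz => by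
    rw [← inner_conj_symm, hGl l hl z hz, map_zero]
  have hL'L : L' ≤ L := inf_le_left.trans hL₁
  let v' : ι → H := fun i => v i + ((t : ℂ) * x i) • e
  have hσe : ∀ s, ∀ l ∈ L', ⟪l, σ s e⟫_ℂ = 0 ∧ ⟪e, σ s l⟫_ℂ = 0 := by
    intro s l hl
    have hs : σ s = ∑ k, b.repr s k • σ (b k) := by
      conv_lhs => rw [← b.sum_repr s, map_sum]
      exact Finset.sum_congr rfl fun k _ => map_smul _ _ _
    rw [hs]
    simp only [sum_apply, smul_apply, inner_sum, inner_smul_right]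
    constructor <;> refine Finset.sum_eq_zero fun k _ => ?_
    · rw [hGl' l hl _ (by simp [G]), mul_zero]
    · rw [← ContinuousLinearMap.adjoint_inner_left, hGl l hl _ (by simp [G]), mul_zero]
  have hAadm : A ∈ admissible V v' L' := by
    refine ⟨hAV, fun i l hl => ⟨?_, ?_⟩, hnull.mono inf_le_left⟩
    · simp [v', hGl' l hl (A (v i)) (by simp [G]),
        hGl' l hl (A e) (by simp [G])]
    · rw [← ContinuousLinearMap.adjoint_inner_left]
      change ⟪ContinuousLinearMap.adjoint A (v i + ((t : ℂ) * x i) • e), l⟫_ℂ = 0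
      rw [map_add, map_smul, inner_add_left, inner_smul_left, hGl l hl _ (by simp [G]),
        hGl l hl _ (by simp [G]), mul_zero, add_zero]
  have hσadm : ∀ s, σ s ∈ admissible V v' L' := by
    intro s
    refine ⟨(hσ s).1, fun i l hl => ⟨?_, ?_⟩, (hσ s).2.2.mono hL'L⟩
    · simp [v', ((hσ s).2.1 i l (hL'L hl)).1, (hσe s l hl).1]
    · simp [v', ((hσ s).2.1 i l (hL'L hl)).2, (hσe s l hl).2]
  refine ⟨v', L', ⟨hL'L, hL₁'.inf_orthogonal _, fun i => ?_, fun i => ?_, fun i l hl => ?_⟩,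
    ht _ (fun s => ⟨σ s, hσadm s, ?_⟩) ⟨A, hAadm, ?_⟩⟩
  · simpa [v'] using L.smul_mem _ heL
  · have h1 : ‖x i‖ * ‖e‖ ≤ ∑ i, ‖x i‖ * ‖e‖ + 1 :=
      (Finset.single_le_sum (f := fun i => ‖x i‖ * ‖e‖) (fun _ _ => by positivity)
        (Finset.mem_univ i)).trans (by linarith)
    calc ‖v' i - v i‖ = t * (‖x i‖ * ‖e‖) := by
          simp [v', norm_smul, abs_of_pos ht0, mul_assoc]
      _ ≤ ε / (∑ i, ‖x i‖ * ‖e‖ + 1) * (∑ i, ‖x i‖ * ‖e‖ + 1) := by gcongr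
      _ = ε := div_mul_cancel₀ _ hκ.ne'
  · simp [v', hv i l (hL'L hl), hGl' l hl e (by simp [G])]
  · ext i j
    have h1 : ⟪v i, σ s (v j)⟫_ℂ = (s : ι → ι → ℂ) i j := congrFun (congrFun (hσg s) i) j
    have h2 := ((hσ s).2.1 i e heL).2
    have h3 := ((hσ s).2.1 j e heL).1
    simp only [gram_apply, v', map_add, map_smul, inner_add_left, inner_add_right, inner_smul_left,
      inner_smul_right, h1, h2, h3, Pi.add_apply, Pi.smul_apply, smul_eq_mul, β, LinearMap.coe_mk,
      AddHom.coe_mk, map_mul, Complex.conj_ofReal]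
    ring
  · ext i j
    simp only [gram_apply, v', Y, map_add, map_smul, inner_add_left, inner_add_right,
      inner_smul_left, inner_smul_right, hA0, he, Pi.add_apply, Pi.smul_apply, smul_eq_mul,
      map_mul, Complex.conj_ofReal]
    ring

end

/-! ### One stage of the construction -/

section

variable {H : Type*} [NormedAddCommGroup H] [InnerProductSpace ℂ H] [CompleteSpace H]

/-- Raising the dimension repeatedly, admissible operators come to realise every matrix. -/
theorem exists_gram_eq_top {V : Submodule ℂ (H →L[ℂ] H)}
    (hV : ∀ (L : Submodule ℂ H) [L.HasOrthogonalProjection], IsLarge L →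
      ¬ FiniteDimensional ℂ (compression L.starProjection V))
    {ι : Type*} [Finite ι] {v : ι → H} {L : Submodule ℂ H} (hL : IsLarge L)
    (hv : ∀ i, ∀ l ∈ L, ⟪l, v i⟫_ℂ = 0) {ε : ℝ} (hε : 0 < ε) :
    ∃ (v' : ι → H) (L' : Submodule ℂ H), Refines ε v L v' L' ∧
      (admissible V v' L').map (gram v') = ⊤ := by
  have key : ∀ k : ℕ, ∀ ε : ℝ, 0 < ε → ∃ (v' : ι → H) (L' : Submodule ℂ H), Refines ε v L v' L' ∧
      ((admissible V v' L').map (gram v') = ⊤ ∨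
        k ≤ Module.finrank ℂ ((admissible V v' L').map (gram v'))) := by
    intro k
    induction k with
    | zero =>
      intro ε hε
      exact ⟨v, L, ⟨le_rfl, hL, by simp, by simp [hε.le], hv⟩, Or.inr (Nat.zero_le _)⟩
    | succ k ih =>
      intro ε hε
      obtain ⟨v', L', h, hk⟩ := ih (ε / 2) (half_pos hε)
      by_cases htop : (admissible V v' L').map (gram v') = ⊤
      · exact ⟨v', L', { h with norm_sub_le := fun i => (h.norm_sub_le i).trans (by linarith) },
          Or.inl htop⟩
      · obtain ⟨v'', L'', h', hlt⟩ :=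
          exists_finrank_gram_lt hV h.isLarge h.orthogonal htop (half_pos hε)
        refine ⟨v'', L'', by simpa using h.trans h', Or.inr ?_⟩
        have := hk.resolve_left htop
        omega
  obtain ⟨v', L', h, hk⟩ := key (Module.finrank ℂ (ι → ι → ℂ) + 1) ε hε
  refine ⟨v', L', h, hk.resolve_right fun hk => ?_⟩
  have := Submodule.finrank_le ((admissible V v' L').map (gram v'))
  omega

/-- Every matrix unit on the family `v` is the Gram matrix of an operator of `V` which
does not couple `v` with `L` and whose form on `L` is bounded by `η`. -/
def IsControlled (V : Submodule ℂ (H →L[ℂ] H)) (η : ℝ) {ι : Type*} [DecidableEq ι] (v : ι → H)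
    (L : Submodule ℂ H) : Prop :=
  ∀ i j, ∃ A ∈ V, (∀ k l, ⟪v k, A (v l)⟫_ℂ = if k = i ∧ l = j then 1 else 0) ∧
    (∀ k, ∀ l ∈ L, ⟪l, A (v k)⟫_ℂ = 0 ∧ ⟪v k, A l⟫_ℂ = 0) ∧
    ∀ x ∈ L, ∀ y ∈ L, ‖⟪x, A y⟫_ℂ‖ ≤ η * ‖x‖ * ‖y‖

theorem exists_isControlled {V : Submodule ℂ (H →L[ℂ] H)}
    (hV : ∀ (L : Submodule ℂ H) [L.HasOrthogonalProjection], IsLarge L →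
      ¬ FiniteDimensional ℂ (compression L.starProjection V))
    {ι : Type*} [Finite ι] [DecidableEq ι] {v : ι → H} {L : Submodule ℂ H} (hL : IsLarge L)
    (hv : ∀ i, ∀ l ∈ L, ⟪l, v i⟫_ℂ = 0) {ε : ℝ} (hε : 0 < ε) {η : ℝ} (hη : 0 < η) :
    ∃ (v' : ι → H) (L' : Submodule ℂ H), Refines ε v L v' L' ∧ IsControlled V η v' L' := by
  obtain ⟨v', L', h, htop⟩ := exists_gram_eq_top hV hL hv hε
  have hA : ∀ p : ι × ι, ∃ A ∈ admissible V v' L',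
      gram v' A = fun k l => if k = p.1 ∧ l = p.2 then 1 else 0 := by
    intro p
    have : (fun k l => if k = p.1 ∧ l = p.2 then (1 : ℂ) else 0) ∈
        (admissible V v' L').map (gram v') := by rw [htop]; trivial
    exact this
  choose A hAadm hAg using hA
  choose F hF hFη using fun p => (hAadm p).2.2 η hη
  refine ⟨v', L' ⊓ (⨆ p, F p)ᗮ,
    ⟨inf_le_left.trans h.le, h.isLarge.inf_orthogonal _, h.sub_mem, h.norm_sub_le,
      fun i l hl => h.orthogonal i l hl.1⟩, fun i j => ⟨A (i, j), (hAadm _).1, fun k l => ?_,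
      fun k l hl => (hAadm _).2.1 k l hl.1, fun x hx y hy => ?_⟩⟩
  · exact congrFun (congrFun (hAg (i, j)) k) l
  · have hle := Submodule.orthogonal_le (le_iSup F (i, j))
    exact hFη _ x ⟨hx.1, hle hx.2⟩ y ⟨hy.1, hle hy.2⟩

/-! ### The recursive construction -/

/-- A state at time `m` consists of vectors, of which the first `m` are in use, and a large
subspace orthogonal to these. -/
def IsState (m : ℕ) (s : (ℕ → H) × Submodule ℂ H) : Prop :=
  IsLarge s.2 ∧ ∀ i < m, ∀ l ∈ s.2, ⟪l, s.1 i⟫_ℂ = 0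

/-- A transition from time `m` to time `m + 1`: the first `m` vectors are moved by at most `ε` so
that they become controlled relative to an intermediate subspace, from which a new unit vector is
taken. -/
def IsTransition (V : Submodule ℂ (H →L[ℂ] H)) (ε η : ℝ) (m : ℕ)
    (s s' : (ℕ → H) × Submodule ℂ H) : Prop :=
  ∃ L' : Submodule ℂ H, IsClosed (L' : Set H) ∧ s'.2 ≤ L' ∧ L' ≤ s.2 ∧
    (∀ i < m, s'.1 i - s.1 i ∈ s.2 ∧ ‖s'.1 i - s.1 i‖ ≤ ε) ∧
    s'.1 m ∈ L' ∧ ‖s'.1 m‖ = 1 ∧ (∀ i < m, ∀ l ∈ L', ⟪l, s'.1 i⟫_ℂ = 0) ∧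
    IsControlled V η (fun i : Fin m => s'.1 i) L'

theorem exists_isTransition {V : Submodule ℂ (H →L[ℂ] H)}
    (hV : ∀ (L : Submodule ℂ H) [L.HasOrthogonalProjection], IsLarge L →
      ¬ FiniteDimensional ℂ (compression L.starProjection V))
    {ε η : ℝ} (hε : 0 < ε) (hη : 0 < η) {m : ℕ} {s : (ℕ → H) × Submodule ℂ H}
    (hs : IsState m s) : ∃ s', IsState (m + 1) s' ∧ IsTransition V ε η m s s' := by
  obtain ⟨w, L', h, hc⟩ := exists_isControlled hV (v := fun i : Fin m => s.1 i) hs.1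
    (fun i => hs.2 i i.2) hε hη
  obtain ⟨f, hfL, hf⟩ := exists_norm_eq_one_of_not_finiteDimensional h.isLarge.2
  let v' : ℕ → H := fun i => if h : i < m then w ⟨i, h⟩ else f
  have hv' : ∀ i (h : i < m), v' i = w ⟨i, h⟩ := fun i h => dif_pos h
  have hv'm : v' m = f := dif_neg (lt_irrefl m)
  refine ⟨(v', L' ⊓ (Submodule.span ℂ {f})ᗮ), ⟨h.isLarge.inf_orthogonal _, fun i hi l hl => ?_⟩,
    L', h.isLarge.1, inf_le_left, h.le, fun i hi => ?_, ?_, ?_, fun i hi l hl => ?_, ?_⟩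
  · rcases Nat.lt_succ_iff_lt_or_eq.1 hi with hi | rfl
    · dsimp only
      rw [hv' i hi]
      exact h.orthogonal _ l hl.1
    · dsimp only
      rw [hv'm]
      exact Submodule.inner_left_of_mem_orthogonal (Submodule.mem_span_singleton_self f) hl.2
  · simp only [hv' i hi]
    exact ⟨h.sub_mem ⟨i, hi⟩, h.norm_sub_le ⟨i, hi⟩⟩
  · dsimp only
    rwa [hv'm]
  · dsimp only
    rwa [hv'm]
  · dsimp only
    rw [hv' i hi]
    exact h.orthogonal _ l hl
  · have : (fun i : Fin m => v' i) = w := funext fun i => hv' i i.2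
    rwa [this]

theorem exists_transition_seq {V : Submodule ℂ (H →L[ℂ] H)} (hH : ¬ FiniteDimensional ℂ H)
    (hV : ∀ (L : Submodule ℂ H) [L.HasOrthogonalProjection], IsLarge L →
      ¬ FiniteDimensional ℂ (compression L.starProjection V))
    {ε η : ℕ → ℝ} (hε : ∀ m, 0 < ε m) (hη : ∀ m, 0 < η m) :
    ∃ s : ℕ → (ℕ → H) × Submodule ℂ H,
      ∀ m, IsState m (s m) ∧ IsTransition V (ε m) (η m) m (s m) (s (m + 1)) := by
  choose! g hg1 hg2 using fun (m : ℕ) (s : (ℕ → H) × Submodule ℂ H) (hs : IsState m s) =>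
    exists_isTransition hV (hε m) (hη m) hs
  let s : ℕ → (ℕ → H) × Submodule ℂ H := fun m => Nat.rec (0, ⊤) (fun m t => g m t) m
  have hs : ∀ m, IsState m (s m) := by
    intro m
    induction m with
    | zero =>
      refine ⟨⟨isClosed_univ, fun h => hH ?_⟩, by simp⟩
      exact Module.Finite.equiv (Submodule.topEquiv (R := ℂ) (M := H))
    | succ m ih => exact hg1 m _ ih
  exact ⟨s, fun m => ⟨hs m, hg2 m _ (hs m)⟩⟩

end

/-! ### The limit of the construction -/

section

variable {H : Type*} [NormedAddCommGroup H] [InnerProductSpace ℂ H]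

/-- If `T` agrees with `a` modulo `L` on the first `m` unit vectors and maps the others into `L`,
then `T x` agrees modulo `L` with the corresponding finite combination of `a`. -/
theorem sub_sum_mem {T : EllTwo →L[ℂ] H} {L : Submodule ℂ H} (hL : IsClosed (L : Set H)) {m : ℕ}
    {a : ℕ → H} (h1 : ∀ i < m, T (unitVec i) - a i ∈ L) (h2 : ∀ i, m ≤ i → T (unitVec i) ∈ L)
    (x : EllTwo) : T x - ∑ i : Fin m, x i • a i ∈ L := by
  let R : EllTwo →L[ℂ] H := T - ∑ i : Fin m, (innerSL ℂ (unitVec i)).smulRight (a i)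
  have hR : ∀ x, R x = T x - ∑ i : Fin m, x i • a i := fun x => by
    simp [R, inner_unitVec_left]
  rw [← hR]
  refine hL.mem_of_tendsto (R.hasSum (hasSum_unitVec x))
    (Eventually.of_forall fun s => L.sum_mem fun n _ => ?_)
  rw [map_smul, hR]
  refine L.smul_mem _ ?_
  rw [Fin.sum_univ_eq_sum_range (fun i => (unitVec n) i • a i) m]
  by_cases hn : n < m
  · simpa [unitVec_apply, hn] using h1 n hn
  · simpa [unitVec_apply, hn] using h2 n (not_lt.1 hn)

/-- Controlled vectors let `V` reproduce the `m × m` corner of any operator `X` along `T`, with an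
error that comes only from the part of `T` in `L`. -/
theorem IsControlled.exists_approx {V : Submodule ℂ (H →L[ℂ] H)} {T : EllTwo →L[ℂ] H}
    {L : Submodule ℂ H} {m : ℕ} {a : ℕ → H} {η : ℝ}
    (h : IsControlled V η (fun i : Fin m => a i) L)
    (ha : ∀ i < m, ∀ l ∈ L, ⟪l, a i⟫_ℂ = 0) (hη : 0 ≤ η)
    (hT : ∀ x, T x - ∑ i : Fin m, x i • a i ∈ L) (X : EllTwo →L[ℂ] EllTwo) :
    ∃ D ∈ V, ∀ x y, ‖⟪T y, D (T x)⟫_ℂ - ⟪truncation m y, X (truncation m x)⟫_ℂ‖ ≤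
      (m : ℝ) ^ 2 * η * (‖X‖ * (‖T y‖ * ‖T x‖)) := by
  choose A hAV hA1 hA2 hA3 using h
  let Q : EllTwo → H := fun x => ∑ i : Fin m, x i • a i
  let R : EllTwo → H := fun x => T x - Q x
  have hRL : ∀ x, R x ∈ L := hT
  have hTQ : ∀ x, T x = Q x + R x := fun x => (add_sub_cancel _ _).symm
  have hRnorm : ∀ x, ‖R x‖ ≤ ‖T x‖ := by
    intro x
    have horth : ⟪R x, Q x⟫_ℂ = 0 := by
      simp only [Q, inner_sum, inner_smul_right]
      exact Finset.sum_eq_zero fun i _ => by rw [ha i i.2 _ (hRL x), mul_zero]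
    have := norm_add_sq_eq_norm_sq_add_norm_sq_of_inner_eq_zero _ _ horth
    rw [add_comm (R x), ← hTQ] at this
    nlinarith [norm_nonneg (R x), norm_nonneg (T x), norm_nonneg (Q x)]
  have hform : ∀ i j x y, ⟪T y, A i j (T x)⟫_ℂ =
      conj (y i) * x j + ⟪R y, A i j (R x)⟫_ℂ := by
    intro i j x y
    have e1 : ⟪Q y, A i j (Q x)⟫_ℂ = conj (y i) * x j := by
      simp only [Q, map_sum, map_smul, sum_inner, inner_sum, inner_smul_left, inner_smul_right, hA1]
      simpa [ite_and] using mul_comm _ _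
    have e2 : ⟪Q y, A i j (R x)⟫_ℂ = 0 := by
      simp only [Q, sum_inner, inner_smul_left]
      exact Finset.sum_eq_zero fun k _ => by rw [(hA2 i j k _ (hRL x)).2, mul_zero]
    have e3 : ⟪R y, A i j (Q x)⟫_ℂ = 0 := by
      simp only [Q, map_sum, map_smul, inner_sum, inner_smul_right]
      exact Finset.sum_eq_zero fun k _ => by rw [(hA2 i j k _ (hRL y)).1, mul_zero]
    rw [hTQ x, hTQ y, map_add, inner_add_left, inner_add_right, inner_add_right, e1, e2, e3]
    ring
  let M : Fin m → Fin m → ℂ := fun i j => ⟪unitVec i, X (unitVec j)⟫_ℂ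
  have hM : ∀ i j, ‖M i j‖ ≤ ‖X‖ := by
    intro i j
    refine (norm_inner_le_norm _ _).trans ?_
    rw [norm_unitVec, one_mul]
    simpa [norm_unitVec] using X.le_opNorm (unitVec j)
  refine ⟨∑ i, ∑ j, M i j • A i j,
    V.sum_mem fun i _ => V.sum_mem fun j _ => V.smul_mem _ (hAV i j), fun x y => ?_⟩
  have hX : ⟪truncation m y, X (truncation m x)⟫_ℂ =
      ∑ i : Fin m, ∑ j : Fin m, M i j * (conj (y i) * x j) := by
    rw [truncation_apply, truncation_apply, ← Fin.sum_univ_eq_sum_range (fun n => y n • unitVec n),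
      ← Fin.sum_univ_eq_sum_range (fun n => x n • unitVec n)]
    simp only [map_sum, map_smul, sum_inner, inner_sum, inner_smul_left, inner_smul_right, M]
    simp only [Finset.mul_sum]
    rw [Finset.sum_comm]
    exact Finset.sum_congr rfl fun i _ => Finset.sum_congr rfl fun j _ => by ring
  have hdiff : ⟪T y, (∑ i, ∑ j, M i j • A i j) (T x)⟫_ℂ -
      ⟪truncation m y, X (truncation m x)⟫_ℂ =
      ∑ i : Fin m, ∑ j : Fin m, M i j * ⟪R y, A i j (R x)⟫_ℂ := by
    rw [hX]
    simp only [sum_apply, smul_apply, inner_sum, inner_smul_right, hform, ← Finset.sum_sub_distrib]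
    refine Finset.sum_congr rfl fun i _ => Finset.sum_congr rfl fun j _ => by ring
  rw [hdiff]
  calc ‖∑ i : Fin m, ∑ j : Fin m, M i j * ⟪R y, A i j (R x)⟫_ℂ‖
      ≤ ∑ i : Fin m, ∑ j : Fin m, ‖X‖ * (η * ‖T y‖ * ‖T x‖) := by
        refine norm_sum_le_of_le _ fun i _ => norm_sum_le_of_le _ fun j _ => ?_
        rw [norm_mul]
        refine mul_le_mul (hM i j) ((hA3 i j _ (hRL y) _ (hRL x)).trans ?_) (norm_nonneg _)
          (norm_nonneg _)
        gcongr
        · exact hRnorm y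
        · exact hRnorm x
    _ = _ := by
        simp only [Finset.sum_const, Finset.card_univ, Fintype.card_fin, nsmul_eq_mul]
        ring

variable [CompleteSpace H]

/-- A small perturbation of an orthonormal sequence spans a copy of `ℓ²(ℕ)`. -/
theorem exists_bounded_below {f w : ℕ → H} (hf : Orthonormal ℂ f)
    (hw : ∀ i, ‖w i - f i‖ ≤ 1 / 4 * (1 / 2) ^ i) :
    ∃ T : EllTwo →L[ℂ] H, (∀ i, T (unitVec i) = w i) ∧ ∀ x, 1 / 2 * ‖x‖ ≤ ‖T x‖ := by
  let r : ℕ → EllTwo →L[ℂ] H := fun i => (innerSL ℂ (unitVec i)).smulRight (w i - f i)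
  have hgeo : HasSum (fun i : ℕ => (1 / 4 : ℝ) * (1 / 2) ^ i) (1 / 2) := by
    have h := hasSum_geometric_two.mul_left (1 / 4 : ℝ)
    rwa [show (1 / 4 : ℝ) * 2 = 1 / 2 by norm_num] at h
  have hr : ∀ i, ‖r i‖ ≤ 1 / 4 * (1 / 2) ^ i := by
    intro i
    rw [ContinuousLinearMap.norm_smulRight_apply, innerSL_apply_norm, norm_unitVec, one_mul]
    exact hw i
  have hsum : HasSum r (∑' i, r i) := (Summable.of_norm_bounded hgeo.summable hr).hasSum
  have hS : ‖∑' i, r i‖ ≤ 1 / 2 := tsum_of_norm_bounded hgeo hr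
  refine ⟨(seqIsometry hf).toContinuousLinearMap + ∑' i, r i, fun i => ?_, fun x => ?_⟩
  · have h1 : HasSum (fun k => r k (unitVec i)) ((∑' k, r k) (unitVec i)) :=
      hsum.mapL (ContinuousLinearMap.apply ℂ H (unitVec i) : (EllTwo →L[ℂ] H) →L[ℂ] H)
    have h2 : HasSum (fun k => r k (unitVec i)) (r i (unitVec i)) := by
      refine hasSum_single i fun k hk => ?_
      simp [r, inner_unitVec_left, unitVec_apply, hk]
    rw [add_apply, h1.unique h2]
    simp [r, norm_unitVec, seqIsometry_unitVec]
  · have h1 : ‖(∑' i, r i) x‖ ≤ 1 / 2 * ‖x‖ :=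
      ((∑' i, r i).le_opNorm x).trans (by gcongr)
    have h2 := norm_sub_le (seqIsometry hf x + (∑' i, r i) x) ((∑' i, r i) x)
    rw [add_sub_cancel_right, LinearIsometry.norm_map] at h2
    change 1 / 2 * ‖x‖ ≤ ‖seqIsometry hf x + (∑' i, r i) x‖
    linarith

/-- When no compression is finite-dimensional, there is a copy `T` of `ℓ²(ℕ)` in `H` along which
`V` approximates every operator in the weak operator topology. -/
theorem exists_approximating_embedding {V : Submodule ℂ (H →L[ℂ] H)}
    (hH : ¬ FiniteDimensional ℂ H)
    (hV : ∀ (L : Submodule ℂ H) [L.HasOrthogonalProjection], IsLarge L →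
      ¬ FiniteDimensional ℂ (compression L.starProjection V)) :
    ∃ T : EllTwo →L[ℂ] H, (∀ x, 1 / 2 * ‖x‖ ≤ ‖T x‖) ∧
      ∀ X : EllTwo →L[ℂ] EllTwo, ∃ D : ℕ → H →L[ℂ] H, (∀ m, D m ∈ V) ∧
        ∀ x y, Tendsto (fun m => ⟪T y, D m (T x)⟫_ℂ) atTop (𝓝 ⟪y, X x⟫_ℂ) := by
  -- The `m ^ 2` matrix entries at stage `m` each contribute an error of order `η m`; the moves of
  -- the `i`-th vector after its introduction add up to at most `(1 / 4) * (1 / 2) ^ i`.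
  have hη : ∀ m : ℕ, (0 : ℝ) < 1 / ((m : ℝ) + 1) ^ 3 := fun m => by positivity
  obtain ⟨s, hs⟩ := exists_transition_seq (V := V) hH hV
    (ε := fun m => 1 / 4 * (1 / 2) ^ m) (fun m => by positivity) hη
  choose L' hLc hL1 hL2 hmove hmem hnorm horth hctl using fun m => (hs m).2
  have hanti : Antitone fun m => (s m).2 := antitone_nat_of_succ_le fun m => (hL1 m).trans (hL2 m)
  have hdrift : ∀ i m k, i < m → m ≤ k → (s k).1 i - (s m).1 i ∈ (s m).2 := by
    intro i m k him hmk
    induction k, hmk using Nat.le_induction with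
    | base => simp
    | succ k hmk ih =>
      have := (s m).2.add_mem (hanti hmk (hmove k i (him.trans_le hmk)).1) ih
      simpa using this
  let f : ℕ → H := fun i => (s (i + 1)).1 i
  have hstep : ∀ i k, dist ((s (i + 1 + k)).1 i) ((s (i + 1 + (k + 1))).1 i) ≤
      1 / 4 * (1 / 2) ^ i / 2 / 2 ^ k := by
    intro i k
    rw [dist_comm, dist_eq_norm]
    refine ((hmove (i + 1 + k) i (by omega)).2).trans (le_of_eq ?_)
    rw [pow_add, pow_add]
    field_simp
    rw [← mul_pow]
    norm_num
  have hlim : ∀ i, ∃ w, Tendsto (fun k => (s (i + 1 + k)).1 i) atTop (𝓝 w) := fun i =>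
    cauchySeq_tendsto_of_complete (cauchySeq_of_le_geometric_two (hstep i))
  choose w hw using hlim
  have hwf : ∀ i, ‖w i - f i‖ ≤ 1 / 4 * (1 / 2) ^ i := by
    intro i
    rw [← dist_eq_norm, dist_comm]
    exact dist_le_of_le_geometric_two_of_tendsto₀ (hstep i) (hw i)
  have hwmem : ∀ i m, i < m → w i - (s m).1 i ∈ (s m).2 := by
    intro i m him
    refine (hs m).1.1.1.mem_of_tendsto ((hw i).sub_const _) ?_
    filter_upwards [eventually_ge_atTop m] with k hk
    exact hdrift i m _ him (by omega)
  have hfmem : ∀ i m, m ≤ i → f i ∈ L' m := by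
    intro i m hmi
    rcases hmi.eq_or_lt with rfl | h
    · exact hmem m
    · exact hL1 m (hanti (Nat.succ_le_of_lt h) (hL2 i (hmem i)))
  have hfo : Orthonormal ℂ f := by
    have key : ∀ i j, j < i → ⟪f i, f j⟫_ℂ = 0 := fun i j hji =>
      (hs (j + 1)).1.2 j (Nat.lt_succ_self j) _
        (hanti (Nat.succ_le_of_lt hji) (hL2 i (hmem i)))
    refine ⟨hnorm, fun i j hij => ?_⟩
    rcases lt_or_gt_of_ne hij with h | h
    · rw [← inner_conj_symm, key j i h, map_zero]
    · exact key i j h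
  obtain ⟨T, hTw, hTb⟩ := exists_bounded_below hfo hwf
  refine ⟨T, hTb, fun X => ?_⟩
  have hTm : ∀ m x, T x - ∑ i : Fin m, x i • (s (m + 1)).1 i ∈ L' m := by
    intro m
    refine sub_sum_mem (hLc m) (fun i hi => ?_) fun i hi => ?_
    · rw [hTw]
      exact hL1 m (hwmem i (m + 1) (by omega))
    · rw [hTw, ← sub_add_cancel (w i) (f i)]
      exact (L' m).add_mem (hL1 m (hanti (by omega) (hwmem i (i + 1) (by omega)))) (hfmem i m hi)
  choose D hDV hD using fun m => (hctl m).exists_approx (horth m) (hη m).le (hTm m) X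
  refine ⟨D, hDV, fun x y => ?_⟩
  have h1 : Tendsto (fun m => ⟪truncation m y, X (truncation m x)⟫_ℂ) atTop (𝓝 ⟪y, X x⟫_ℂ) :=
    (tendsto_truncation y).inner ((X.continuous.tendsto _).comp (tendsto_truncation x))
  have h2 : Tendsto (fun m : ℕ => 1 / ((m : ℝ) + 1) * (‖X‖ * (‖T y‖ * ‖T x‖))) atTop (𝓝 0) := by
    simpa using tendsto_one_div_add_atTop_nhds_zero_nat.mul_const (‖X‖ * (‖T y‖ * ‖T x‖))
  have h3 : Tendsto (fun m => ⟪T y, D m (T x)⟫_ℂ - ⟪truncation m y, X (truncation m x)⟫_ℂ)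
      atTop (𝓝 0) := by
    refine squeeze_zero_norm (fun m => (hD m x y).trans ?_) h2
    refine mul_le_mul_of_nonneg_right ?_ (by positivity)
    rw [mul_one_div, div_le_div_iff₀ (by positivity) (by positivity)]
    have : (0 : ℝ) ≤ m := Nat.cast_nonneg m
    nlinarith [mul_nonneg this this]
  simpa using h3.add h1

/-- The clique alternative: if no compression to an infinite-dimensional closed subspace is
finite-dimensional, some compression is weakly dense. -/
theorem exists_isInfiniteQuantumClique {V : Submodule ℂ (H →L[ℂ] H)}
    (hH : ¬ FiniteDimensional ℂ H)
    (hV : ∀ (L : Submodule ℂ H) [L.HasOrthogonalProjection], IsLarge L →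
      ¬ FiniteDimensional ℂ (compression L.starProjection V)) :
    ∃ P : H →L[ℂ] H, IsInfiniteQuantumClique V P := by
  obtain ⟨T, hTb, hT⟩ := exists_approximating_embedding hH hV
  have hlarge : IsLarge T.range := isLarge_range (by norm_num) hTb
  have : CompleteSpace T.range := hlarge.1.completeSpace_coe
  set P := T.range.starProjection with hP
  have hrange : ∀ x, ∃ x', T x' = P x := fun x => Submodule.starProjection_apply_mem T.range x
  refine ⟨P, ⟨isStarProjection_starProjection, ?_⟩, ?_⟩
  · rw [hP, Submodule.range_starProjection]
    exact hlarge.2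
  rintro _ ⟨_, hB, rfl⟩
  obtain ⟨B, -, rfl⟩ := (mem_compression P ⊤ _).1 hB
  obtain ⟨D, hDV, hD⟩ := hT (ContinuousLinearMap.adjoint T ∘L B ∘L T)
  refine mem_closure_of_tendsto (f := fun m => ContinuousLinearMapWOT.ofCLM (P * D m * P))
    (b := atTop) ?_ (Eventually.of_forall fun m =>
      ⟨_, (mem_compression P V _).2 ⟨D m, hDV m, rfl⟩, rfl⟩)
  rw [ContinuousLinearMapWOT.tendsto_iff_forall_inner_apply_tendsto]
  intro x y
  obtain ⟨x', hx'⟩ := hrange x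
  obtain ⟨y', hy'⟩ := hrange y
  have key : ∀ C : H →L[ℂ] H, ⟪y, (P * C * P) x⟫_ℂ = ⟪T y', C (T x')⟫_ℂ := by
    intro C
    rw [hx', hy']
    exact (Submodule.inner_starProjection_left_eq_right T.range y (C (P x))).symm
  simp only [ContinuousLinearMapWOT.ofCLM_apply, key]
  simpa [ContinuousLinearMap.adjoint_inner_right] using hD x' y'

end

/-! ### Finite-dimensional compressions -/

section

variable {H : Type*} [NormedAddCommGroup H] [InnerProductSpace ℂ H] [CompleteSpace H]

/-- The orthogonal projection onto the closed span of an orthonormal sequence. -/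
noncomputable def seqProjection {e : ℕ → H} (he : Orthonormal ℂ e) : H →L[ℂ] H :=
  (seqIsometry he).toContinuousLinearMap ∘L
    ContinuousLinearMap.adjoint (seqIsometry he).toContinuousLinearMap

theorem adjoint_seqIsometry_apply {e : ℕ → H} (he : Orthonormal ℂ e) (x : EllTwo) :
    ContinuousLinearMap.adjoint (seqIsometry he).toContinuousLinearMap (seqIsometry he x) = x := by
  refine ext_inner_left ℂ fun y => ?_
  rw [ContinuousLinearMap.adjoint_inner_right]
  exact (seqIsometry he).inner_map_map y x

theorem seqProjection_seqIsometry {e : ℕ → H} (he : Orthonormal ℂ e) (x : EllTwo) :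
    seqProjection he (seqIsometry he x) = seqIsometry he x :=
  congrArg (seqIsometry he) (adjoint_seqIsometry_apply he x)

theorem seqProjection_apply_self {e : ℕ → H} (he : Orthonormal ℂ e) (n : ℕ) :
    seqProjection he (e n) = e n := by
  rw [← seqIsometry_unitVec he, seqProjection_seqIsometry]

theorem isStarProjection_seqProjection {e : ℕ → H} (he : Orthonormal ℂ e) :
    IsStarProjection (seqProjection he) := by
  refine ⟨?_, ?_⟩
  · ext x
    exact seqProjection_seqIsometry he _
  · rw [IsSelfAdjoint, ContinuousLinearMap.star_eq_adjoint, seqProjection,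
      ContinuousLinearMap.adjoint_comp, ContinuousLinearMap.adjoint_adjoint]

theorem range_seqProjection {e : ℕ → H} (he : Orthonormal ℂ e) :
    (seqProjection he).range = (seqIsometry he).toContinuousLinearMap.range := by
  apply le_antisymm
  · rintro _ ⟨x, rfl⟩
    exact ⟨_, rfl⟩
  · rintro _ ⟨x, rfl⟩
    exact ⟨_, seqProjection_seqIsometry he x⟩

theorem isLarge_range_seqProjection {e : ℕ → H} (he : Orthonormal ℂ e) :
    IsLarge (seqProjection he).range := by
  rw [range_seqProjection]
  exact isLarge_range (T := (seqIsometry he).toContinuousLinearMap) one_pos fun x => by simp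

theorem isInfiniteRankProjection_seqProjection {e : ℕ → H} (he : Orthonormal ℂ e) :
    IsInfiniteRankProjection (seqProjection he) :=
  ⟨isStarProjection_seqProjection he, (isLarge_range_seqProjection he).2⟩

section Diagonal

variable {e : ℕ → H} (he : Orthonormal ℂ e) {C : H →L[ℂ] H}
  (hC : ∀ m n, m ≠ n → ⟪e m, C (e n)⟫_ℂ = 0)

include hC

theorem isCompactOperator_seqProjection_mul
    (h0 : Tendsto (fun n => ⟪e n, C (e n)⟫_ℂ) atTop (𝓝 0)) :
    IsCompactOperator (seqProjection he * C * seqProjection he) :=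
  ((isCompactOperator_diagonal (adjoint_seqIsometry_comp_apply he hC) h0).comp_clm
    (ContinuousLinearMap.adjoint (seqIsometry he).toContinuousLinearMap)).clm_comp
      (seqIsometry he).toContinuousLinearMap

theorem seqProjection_mul_apply_self (n : ℕ) :
    (seqProjection he * C * seqProjection he) (e n) = ⟪e n, C (e n)⟫_ℂ • e n := by
  have h : (ContinuousLinearMap.adjoint (seqIsometry he).toContinuousLinearMap ∘L C ∘L
      (seqIsometry he).toContinuousLinearMap) (unitVec n) = ⟪e n, C (e n)⟫_ℂ • unitVec n := by
    ext m
    rw [adjoint_seqIsometry_comp_apply he hC, lp.coeFn_smul, Pi.smul_apply, unitVec_apply]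
    by_cases hmn : m = n
    · simp [hmn]
    · simp [hmn]
  have h2 := congrArg (seqIsometry he) h
  rw [map_smul, seqIsometry_unitVec] at h2
  rw [← h2]
  change seqProjection he (C (seqProjection he (e n))) = _
  rw [seqProjection_apply_self]
  change _ = seqProjection he (C (seqIsometry he (unitVec n)))
  rw [seqIsometry_unitVec]

theorem seqProjection_mul_eq_zero (h0 : ∀ n, ⟪e n, C (e n)⟫_ℂ = 0) :
    seqProjection he * C * seqProjection he = 0 := by
  ext x
  have : (ContinuousLinearMap.adjoint (seqIsometry he).toContinuousLinearMap ∘L C ∘L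
      (seqIsometry he).toContinuousLinearMap)
      (ContinuousLinearMap.adjoint (seqIsometry he).toContinuousLinearMap x) = 0 := by
    ext n
    rw [adjoint_seqIsometry_comp_apply he hC, h0, zero_mul]
    rfl
  exact (congrArg (seqIsometry he) this).trans (map_zero _)

theorem topologicalClosure_range_seqProjection_mul (h0 : ∀ n, ⟪e n, C (e n)⟫_ℂ ≠ 0) :
    (seqProjection he * C * seqProjection he).range.topologicalClosure =
      (seqProjection he).range := by
  apply le_antisymm
  · refine Submodule.topologicalClosure_minimal _ ?_ (isLarge_range_seqProjection he).1
    rintro _ ⟨x, rfl⟩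
    exact ⟨_, rfl⟩
  · rw [range_seqProjection]
    rintro _ ⟨x, rfl⟩
    refine seqIsometry_mem he (Submodule.isClosed_topologicalClosure _) (fun n => ?_) x
    refine Submodule.le_topologicalClosure _ ⟨(⟪e n, C (e n)⟫_ℂ)⁻¹ • e n, ?_⟩
    rw [ContinuousLinearMap.coe_coe, map_smul, seqProjection_mul_apply_self he hC,
      inv_smul_smul₀ (h0 n)]

end Diagonal

theorem exists_selfAdjoint_generators {V : Submodule ℂ (H →L[ℂ] H)} (hV : IsOperatorSystem V)
    (P : H →L[ℂ] H) (hP : FiniteDimensional ℂ (compression P V)) :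
    ∃ s : Finset (H →L[ℂ] H), (∀ A ∈ s, A ∈ V ∧ IsSelfAdjoint A) ∧
      ∀ B ∈ V, P * B * P ∈ Submodule.span ℂ ((fun A => P * A * P) '' (s : Set (H →L[ℂ] H))) := by
  classical
  obtain ⟨t, ht⟩ := (Submodule.fg_iff_finiteDimensional _).2 hP
  have hlift : ∀ c : t, ∃ A ∈ V, P * A * P = c := fun c =>
    (mem_compression P V _).1 (ht ▸ Submodule.subset_span c.2)
  choose A hAV hA using hlift
  let g₁ : t → H →L[ℂ] H := fun c => A c + star (A c)
  let g₂ : t → H →L[ℂ] H := fun c => Complex.I • (A c - star (A c))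
  refine ⟨Finset.univ.image g₁ ∪ Finset.univ.image g₂, fun B hB => ?_, fun B hB => ?_⟩
  · rcases Finset.mem_union.1 hB with hB | hB <;> obtain ⟨c, -, rfl⟩ := Finset.mem_image.1 hB
    · refine ⟨V.add_mem (hAV c) (hV.adjoint_mem _ (hAV c)), ?_⟩
      simp [g₁, IsSelfAdjoint, add_comm]
    · refine ⟨V.smul_mem _ (V.sub_mem (hAV c) (hV.adjoint_mem _ (hAV c))), ?_⟩
      simp [g₂, IsSelfAdjoint, ← smul_neg]
  · have hle : Submodule.span ℂ (t : Set (H →L[ℂ] H)) ≤ Submodule.span ℂ ((fun A => P * A * P) ''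
        ((Finset.univ.image g₁ ∪ Finset.univ.image g₂ : Finset _) : Set (H →L[ℂ] H))) := by
      rw [Submodule.span_le]
      intro c hc
      have h1 := Submodule.subset_span (R := ℂ) (Set.mem_image_of_mem (fun A => P * A * P)
        (show g₁ ⟨c, hc⟩ ∈ ((Finset.univ.image g₁ ∪ Finset.univ.image g₂ : Finset _) :
          Set (H →L[ℂ] H)) by simp))
      have h2 := Submodule.subset_span (R := ℂ) (Set.mem_image_of_mem (fun A => P * A * P)
        (show g₂ ⟨c, hc⟩ ∈ ((Finset.univ.image g₁ ∪ Finset.univ.image g₂ : Finset _) :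
          Set (H →L[ℂ] H)) by simp))
      have h3 := Submodule.smul_mem _ (1 / 2 : ℂ) (Submodule.sub_mem _ h1
        (Submodule.smul_mem _ Complex.I h2))
      have h4 : (1 / 2 : ℂ) • (P * g₁ ⟨c, hc⟩ * P - Complex.I • (P * g₂ ⟨c, hc⟩ * P)) = c := by
        refine Eq.trans ?_ (hA ⟨c, hc⟩)
        simp only [g₁, g₂, mul_smul_comm, smul_mul_assoc, smul_smul, Complex.I_mul_I, mul_add,
          add_mul, mul_sub, sub_mul]
        module
      exact h4 ▸ h3
    exact hle (ht ▸ (mem_compression P V _).2 ⟨B, hB, rfl⟩)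

/-- If some compression is finite-dimensional, its generators can be diagonalised
simultaneously along an orthonormal sequence, with convergent diagonals. If the diagonals agree
with their limits infinitely often there is an anticlique; otherwise one generator differs from
its limit infinitely often, and this gives an obstruction. -/
theorem exists_anticlique_or_obstruction {V : Submodule ℂ (H →L[ℂ] H)} (hV : IsOperatorSystem V)
    {L : Submodule ℂ H} [L.HasOrthogonalProjection] (hL : IsLarge L)
    (hfin : FiniteDimensional ℂ (compression L.starProjection V)) :
    (∃ P : H →L[ℂ] H, IsInfiniteQuantumAnticlique V P) ∨
      (∃ P : H →L[ℂ] H, IsInfiniteQuantumObstruction V P) := by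
  obtain ⟨s, hs, hgen⟩ := exists_selfAdjoint_generators hV L.starProjection hfin
  obtain ⟨e, he, heL, hoff, a, ha⟩ :=
    exists_orthonormal_diagonal hL.2 (fun A : s => (A : H →L[ℂ] H))
  let C : s → H →L[ℂ] H := fun A => A - a A • 1
  have hCV : ∀ A, C A ∈ V := fun A => V.sub_mem (hs A A.2).1 (V.smul_mem _ hV.one_mem)
  have hCoff : ∀ A m n, m ≠ n → ⟪e m, C A (e n)⟫_ℂ = 0 := by
    intro A m n hmn
    simp [C, hoff A m n hmn, he.2 hmn]
  have hClim : ∀ A, Tendsto (fun n => ⟪e n, C A (e n)⟫_ℂ) atTop (𝓝 0) := by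
    intro A
    rw [← sub_self (a A)]
    refine ((ha A).sub_const (a A)).congr fun n => ?_
    simp [C, he.1 n]
  have hCsa : ∀ A, IsSelfAdjoint (C A) := by
    intro A
    have hreal : conj (a A) = a A := by
      refine tendsto_nhds_unique ((Complex.continuous_conj.tendsto _).comp (ha A)) ?_
      refine (ha A).congr fun n => ?_
      simp only [Function.comp_apply]
      rw [inner_conj_symm, ← ContinuousLinearMap.adjoint_inner_left,
        ContinuousLinearMap.isSelfAdjoint_iff'.1 (hs A A.2).2]
    refine (hs A A.2).2.sub ?_
    simp [IsSelfAdjoint, hreal]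
  -- Compressing along a subsequence keeps the generating property of `s`.
  have hspan : ∀ (φ : ℕ → ℕ) (hφ : StrictMono φ), compression
      (seqProjection (he.comp φ hφ.injective)) V ≤ Submodule.span ℂ
        ((fun A => seqProjection (he.comp φ hφ.injective) * A *
          seqProjection (he.comp φ hφ.injective)) '' (s : Set (H →L[ℂ] H))) := by
    intro φ hφ B hB
    obtain ⟨B, hBV, rfl⟩ := (mem_compression _ _ _).1 hB
    set Q := seqProjection (he.comp φ hφ.injective) with hQ
    have hQL : L.starProjection * Q = Q := by
      ext x
      refine Submodule.starProjection_eq_self_iff.2 ?_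
      exact seqIsometry_mem (he.comp φ hφ.injective) hL.1 (fun n => heL (φ n)) _
    have hLQ : Q * L.starProjection = Q := by
      have := congrArg star hQL
      rwa [star_mul, (isStarProjection_seqProjection _).isSelfAdjoint.star_eq,
        (isStarProjection_starProjection (U := L)).isSelfAdjoint.star_eq] at this
    have hcomp : ∀ A : H →L[ℂ] H,
        Q * A * Q = Q * (L.starProjection * A * L.starProjection) * Q := by
      intro A
      calc Q * A * Q = Q * L.starProjection * A * (L.starProjection * Q) := by rw [hLQ, hQL]
        _ = _ := by simp only [mul_assoc]
    have h1 := Submodule.mem_map_of_mem (f := LinearMap.mulLeftRight ℂ (Q, Q)) (hgen B hBV)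
    rw [Submodule.map_span, Set.image_image] at h1
    simpa only [LinearMap.mulLeftRight_apply, ← hcomp] using h1
  have hdecomp : ∀ (P : H →L[ℂ] H), IsIdempotentElem P → ∀ A : s,
      P * A * P = a A • P + P * C A * P := by
    intro P hP A
    simp only [C, mul_sub, sub_mul, mul_smul_comm, smul_mul_assoc, mul_one, hP.eq]
    abel
  by_cases h : ∃ A, ∃ᶠ n in atTop, ⟪e n, C A (e n)⟫_ℂ ≠ 0
  · right
    obtain ⟨A, hA⟩ := h
    obtain ⟨φ, hφ, hne⟩ := extraction_of_frequently_atTop hA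
    set P := seqProjection (he.comp φ hφ.injective) with hP
    have hPproj := isStarProjection_seqProjection (he.comp φ hφ.injective)
    have hcpt : ∀ A, IsCompactOperator (P * C A * P) := fun A =>
      isCompactOperator_seqProjection_mul _ (fun m n hmn => hCoff A _ _ (hφ.injective.ne hmn))
        ((hClim A).comp hφ.tendsto_atTop)
    refine ⟨P, isInfiniteRankProjection_seqProjection _, ?_, fun B hB => ?_, P * C A * P,
      (mem_compression _ _ _).2 ⟨_, hCV A, rfl⟩, ?_, hcpt A,
      topologicalClosure_range_seqProjection_mul _
        (fun m n hmn => hCoff A _ _ (hφ.injective.ne hmn)) hne⟩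
    · have := FiniteDimensional.span_of_finite ℂ
        (s.finite_toSet.image fun A => P * A * P)
      exact Submodule.finiteDimensional_of_le (hspan φ hφ)
    · have hle : Submodule.span ℂ ((fun A => P * A * P) '' (s : Set (H →L[ℂ] H))) ≤
          Submodule.span ℂ {P} ⊔ compactOperator (RingHom.id ℂ) H H := by
        rw [Submodule.span_le]
        rintro _ ⟨A, hA, rfl⟩
        refine Submodule.mem_sup.2 ⟨_, Submodule.smul_mem _ (a ⟨A, hA⟩)
          (Submodule.mem_span_singleton_self P), _, hcpt ⟨A, hA⟩, ?_⟩
        exact (hdecomp P hPproj.isIdempotentElem ⟨A, hA⟩).symm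
      obtain ⟨y, hy, K, hK, hyK⟩ := Submodule.mem_sup.1 (hle (hspan φ hφ hB))
      obtain ⟨c, rfl⟩ := Submodule.mem_span_singleton.1 hy
      exact ⟨c, K, hK, hyK.symm⟩
    · rw [IsSelfAdjoint, star_mul, star_mul, hPproj.isSelfAdjoint.star_eq, (hCsa A).star_eq,
        mul_assoc]
  · left
    simp only [not_exists, not_frequently, not_not] at h
    obtain ⟨φ, hφ, hzero⟩ := extraction_of_frequently_atTop (eventually_all.2 h).frequently
    refine ⟨seqProjection (he.comp φ hφ.injective), isInfiniteRankProjection_seqProjection _,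
      le_antisymm ((hspan φ hφ).trans ?_) ?_⟩
    · rw [Submodule.span_le]
      rintro _ ⟨A, hA, rfl⟩
      have h1 := hdecomp _
        (isStarProjection_seqProjection (he.comp φ hφ.injective)).isIdempotentElem ⟨A, hA⟩
      rw [seqProjection_mul_eq_zero _
        (fun m n hmn => hCoff ⟨A, hA⟩ _ _ (hφ.injective.ne hmn)) (fun n => hzero n _),
        add_zero] at h1
      exact Submodule.mem_span_singleton.2 ⟨_, h1.symm⟩
    · rw [Submodule.span_singleton_le_iff_mem, mem_compression]
      refine ⟨1, hV.one_mem, ?_⟩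
      rw [mul_one]
      exact (isStarProjection_seqProjection _).isIdempotentElem.eq

end

theorem theorem1p3 {H : Type*} [NormedAddCommGroup H] [InnerProductSpace ℂ H] [CompleteSpace H]
    (hH : ¬ FiniteDimensional ℂ H) (V : Submodule ℂ (H →L[ℂ] H)) (hV : IsOperatorSystem V) :
    (∃ P : H →L[ℂ] H, IsInfiniteQuantumClique V P) ∨
      (∃ P : H →L[ℂ] H, IsInfiniteQuantumAnticlique V P) ∨
      (∃ P : H →L[ℂ] H, IsInfiniteQuantumObstruction V P) := by
  by_cases h : ∀ (L : Submodule ℂ H) [L.HasOrthogonalProjection], IsLarge L →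
      ¬ FiniteDimensional ℂ (compression L.starProjection V)
  · exact Or.inl (exists_isInfiniteQuantumClique hH h)
  · push Not at h
    obtain ⟨L, hLp, hL, hfin⟩ := h
    exact Or.inr (exists_anticlique_or_obstruction hV hL hfin)
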